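/- Let $M$ be a matroid with ground set $E$ and rank $r \in \mathbb{N}$. A labelled basis of $M$ is a pair $(B,l)$ where $B$ is a basis of $M$ and $l : B \to \{1,\dots,r\}$ is a bijection; the element with label $i$ is $l^{-1}(i)$. A basis exchange step replaces an element $e \in B$ by an element $e' \in E \setminus B$ such that $(B \setminus \{e\}) \cup \{e'\}$ is a basis; the element $e'$ gets the label $l(e)$, and all other elements keep their labels. The connected components of $M$ are the equivalence classes of the relation on $E$ that relates $e$ and $f$ if $e = f$ or some circuit of $M$ contains both $e$ and $f$. Theorem. There is an absolute constant $C$ such that the following holds for every $r$ and every matroid $M$ of rank $r$. If $\mathcal{T}_1$ and $\mathcal{T}_2$ are two labelled bases of $M$ such that, for each label $i$, the element with label $i$ in $\mathcal{T}_1$ and the element with label $i$ in $\mathcal{T}_2$ lie in the same connected component of $M$, then $\mathcal{T}_1$ can be reconfigured to $\mathcal{T}_2$ by a sequence of at most $C\, r^{1.5}$ basis exchange steps. -/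

import Mathlib

namespace Matroid

/-- The relation `e ψ f` on the elements of a matroid: `e = f`, or some circuit contains both. -/
def CircuitRel {α : Type*} (M : Matroid α) (e f : α) : Prop :=
  e = f ∨ ∃ C, M.IsCircuit C ∧ e ∈ C ∧ f ∈ C

/-- The connected components of a matroid: the classes of the relation `CircuitRel` on its
ground set. -/
def IsConnectedComponent {α : Type*} (M : Matroid α) (K : Set α) : Prop :=
  ∃ e ∈ M.E, K = {f ∈ M.E | M.CircuitRel e f}

/-- A labelled basis `(B, l)` of a matroid of rank `r`: a basis `B` together with a labelling that
assigns a unique label to each element of `B`. The `r` labels are the elements of `Fin r`; since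
`B` has `r` elements, the labelling is a bijection. -/
structure LabelledBasis {α : Type*} (M : Matroid α) (r : ℕ) where
  basis : Set α
  isBase : M.IsBase basis
  label : basis ≃ Fin r

namespace LabelledBasis

/-- The element `l⁻¹(i)` with label `i`. -/
def elt {α : Type*} {M : Matroid α} {r : ℕ} (T : M.LabelledBasis r) (i : Fin r) : α :=
  (T.label.symm i : α)

/-- `T.Exchange T'`: one basis exchange step leads from `T` to `T'`. It replaces an element `e` of
the basis by an element `e'` outside it; `e'` gets the label of `e`, and all other elements keep
their labels. -/
def Exchange {α : Type*} {M : Matroid α} {r : ℕ} (T T' : M.LabelledBasis r) : Prop :=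
  ∃ (e e' : α) (he : e ∈ T.basis) (he' : e' ∈ T'.basis),
    e' ∈ M.E \ T.basis ∧ T'.basis = insert e' (T.basis \ {e}) ∧
    T'.label ⟨e', he'⟩ = T.label ⟨e, he⟩ ∧
    ∀ (x : α) (hx : x ∈ T.basis) (hx' : x ∈ T'.basis), T'.label ⟨x, hx'⟩ = T.label ⟨x, hx⟩

/-- `ReconfigurableIn k T T'`: a sequence of exactly `k` basis exchange steps reconfigures `T`
to `T'`. -/
inductive ReconfigurableIn {α : Type*} {M : Matroid α} {r : ℕ} :
    ℕ → M.LabelledBasis r → M.LabelledBasis r → Prop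
  | refl (T : M.LabelledBasis r) : ReconfigurableIn 0 T T
  | tail {k : ℕ} {T T' T'' : M.LabelledBasis r} :
      ReconfigurableIn k T T' → T'.Exchange T'' → ReconfigurableIn (k + 1) T T''

end LabelledBasis

end Matroid

open Set Function

/-! ### Connectivity by circuits and sets of small nullity -/

namespace Matroid

/-! Exchange the first basis into the second in at most `r` steps. Each step stays inside
components, so what remains is a permutation of labels within components, a product of at most `r`
transpositions of related elements.

One transposition is cheap if some circuit through both elements has few elements outside the basis.
To arrange this for `m` transpositions at once, attach ears: their at most `2m` endpoints lie in a
finite set `X` of nullity at most `2m` that preserves the connectivity relation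
(`exists_superset_nullity_le`). The endpoints extend to a base missing at most `2m` elements of `X`.
Moving there and back costs `2r`, and each transposition costs `4m + 3`.

With `m` about `√r` there are at most `m` batches, and `r + m (2r + m (4m + 3))` is of order
`r^1.5`. -/

theorem CircuitRel.symm {α : Type*} {M : Matroid α} {e f : α} (h : M.CircuitRel e f) :
    M.CircuitRel f e := by
  obtain rfl | ⟨C, hC, he, hf⟩ := h
  · exact Or.inl rfl
  · exact Or.inr ⟨C, hC, hf, he⟩

/-- Two elements of intersecting circuits lie in a common circuit. -/
theorem IsCircuit.exists_isCircuit_of_inter_nonempty {α : Type*} {M : Matroid α} [M.Finitary]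
    {C₁ C₂ : Set α} (hC₁ : M.IsCircuit C₁) (hC₂ : M.IsCircuit C₂) {e g : α} (he : e ∈ C₁)
    (hg : g ∈ C₂) (hne : (C₁ ∩ C₂).Nonempty) : ∃ C, M.IsCircuit C ∧ e ∈ C ∧ g ∈ C := by
  induction hn : (C₁ ∪ C₂).ncard using Nat.strong_induction_on generalizing C₁ C₂ with
  | _ n ih =>
  subst hn
  by_contra hcon
  have hfin : (C₁ ∪ C₂).Finite := hC₁.finite.union hC₂.finite
  -- The counterexample has minimal union, so no such pair inside it has a smaller one.
  have key : ∀ D₁ D₂, M.IsCircuit D₁ → M.IsCircuit D₂ → e ∈ D₁ → g ∈ D₂ →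
      (D₁ ∩ D₂).Nonempty → D₁ ∪ D₂ ⊆ C₁ ∪ C₂ → D₁ ∪ D₂ = C₁ ∪ C₂ := by
    intro D₁ D₂ h₁ h₂ he' hg' hne' hss
    by_contra hneq
    exact hcon (ih _ (ncard_lt_ncard (hss.ssubset_of_ne hneq) hfin) h₁ h₂ he' hg' hne' rfl)
  obtain ⟨f, hf₁, hf₂⟩ := hne
  have heC₂ : e ∉ C₂ := fun h ↦ hcon ⟨C₂, hC₂, h, hg⟩
  have hgC₁ : g ∉ C₁ := fun h ↦ hcon ⟨C₁, hC₁, he, h⟩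
  obtain ⟨C₃, hs₃, hC₃, he₃⟩ := hC₁.strong_elimination hC₂ hf₁ hf₂ he heC₂
  obtain ⟨C₄, hs₄, hC₄, hg₄⟩ := hC₂.strong_elimination hC₁ hf₂ hf₁ hg hgC₁
  rw [union_comm C₂] at hs₄
  have hs₃' : C₃ ⊆ C₁ ∪ C₂ := hs₃.trans sdiff_subset
  have hs₄' : C₄ ⊆ C₁ ∪ C₂ := hs₄.trans sdiff_subset
  have hf₃ : f ∉ C₃ := fun h ↦ (hs₃ h).2 rfl
  have hf₄ : f ∉ C₄ := fun h ↦ (hs₄ h).2 rfl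
  obtain ⟨x, hx₃, hx₁⟩ : ∃ x ∈ C₃, x ∉ C₁ := by
    by_contra! h
    exact hf₃ (hC₃.eq_of_subset_isCircuit hC₁ h ▸ hf₁)
  have hx₂ : x ∈ C₂ := (hs₃' hx₃).resolve_left hx₁
  obtain ⟨y, hy₄, hy₂⟩ : ∃ y ∈ C₄, y ∉ C₂ := by
    by_contra! h
    exact hf₄ (hC₄.eq_of_subset_isCircuit hC₂ h ▸ hf₂)
  have hy₁ : y ∈ C₁ := (hs₄' hy₄).resolve_right hy₂
  have h₁₄ := key C₁ C₄ hC₁ hC₄ he hg₄ ⟨y, hy₁, hy₄⟩ (union_subset subset_union_left hs₄')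
  have hx₄ : x ∈ C₄ := by
    have : x ∈ C₁ ∪ C₄ := h₁₄ ▸ Or.inr hx₂
    exact this.resolve_left hx₁
  -- This pair meets in `x`, but its union misses `f`, against minimality.
  have h₃₄ := key C₃ C₄ hC₃ hC₄ he₃ hg₄ ⟨x, hx₃, hx₄⟩ (union_subset hs₃' hs₄')
  have : f ∈ C₃ ∪ C₄ := h₃₄ ▸ Or.inl hf₁
  exact this.elim hf₃ hf₄

theorem CircuitRel.trans {α : Type*} {M : Matroid α} [M.Finitary] {e f g : α}
    (h : M.CircuitRel e f) (h' : M.CircuitRel f g) : M.CircuitRel e g := by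
  obtain rfl | ⟨C, hC, he, hf⟩ := h
  · exact h'
  obtain rfl | ⟨C', hC', hf', hg⟩ := h'
  · exact Or.inr ⟨C, hC, he, hf⟩
  exact Or.inr (hC.exists_isCircuit_of_inter_nonempty hC' he hg ⟨f, hf, hf'⟩)

theorem CircuitRel.of_restrict {α : Type*} {M : Matroid α} {X Y : Set α} (hXY : X ⊆ Y)
    (hY : Y ⊆ M.E) {e f : α} (h : (M ↾ X).CircuitRel e f) : (M ↾ Y).CircuitRel e f := by
  obtain rfl | ⟨C, hC, he, hf⟩ := h
  · exact Or.inl rfl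
  rw [restrict_isCircuit_iff (hXY.trans hY)] at hC
  exact Or.inr ⟨C, (restrict_isCircuit_iff hY).2 ⟨hC.1, hC.2.trans hXY⟩, he, hf⟩

/-- Every circuit through `e ∉ X` that meets `X` contains outside `X` an ear through `e`: a set
`D \ X` for a circuit `D` through `e` that meets `X`, such that adding `D` to an independent subset
`I` of `X` increases the nullity by at most one. -/
theorem IsCircuit.exists_ear {α : Type*} {M : Matroid α} {X I C : Set α} {e : α}
    (hC : M.IsCircuit C) (heC : e ∈ C) (heX : e ∉ X) (hCX : (C ∩ X).Nonempty) (hX : X ⊆ M.E)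
    (hI : M.Indep I) (hIX : I ⊆ X) :
    ∃ D J, M.IsCircuit D ∧ e ∈ D ∧ (D ∩ X).Nonempty ∧ M.Indep J ∧ J ⊆ X ∪ D ∧
      (X ∪ D) \ J ⊆ insert e (X \ I) := by
  have hCE := hC.subset_ground
  obtain ⟨J, hJ, hIJ⟩ := hI.subset_isBasis_of_subset (hIX.trans subset_union_left)
    (union_subset hX (sdiff_subset.trans hCE) : X ∪ (C \ {e}) ⊆ M.E)
  have heJ : e ∉ J := fun h ↦ (hJ.subset h).elim heX fun h' ↦ h'.2 rfl
  have hecl : e ∈ M.closure J := by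
    rw [hJ.closure_eq_closure]
    exact M.closure_subset_closure subset_union_right
      (hC.mem_closure_sdiff_singleton_of_mem heC)
  have hD := hJ.indep.fundCircuit_isCircuit hecl heJ
  have heD := M.mem_fundCircuit e J
  have hDJ := M.fundCircuit_subset_insert e J
  set D := M.fundCircuit e J
  have hDJ' : D \ {e} ⊆ J := by
    rintro x ⟨hx, hxe⟩
    exact (hDJ hx).resolve_left hxe
  refine ⟨D, I ∪ (D \ {e}), hD, heD, ?_, hJ.indep.subset (union_subset hIJ hDJ'),
    union_subset_union hIX sdiff_subset, ?_⟩
  -- An ear disjoint from `X` would lie in `C`, hence equal `C`, which meets `X`.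
  · by_contra hemp
    rw [not_nonempty_iff_eq_empty] at hemp
    have hDC : D ⊆ C := by
      intro x hx
      by_cases hxe : x = e
      · exact hxe ▸ heC
      · have hxX : x ∉ X := fun h ↦ by
          have : x ∈ D ∩ X := ⟨hx, h⟩
          simp [hemp] at this
        exact ((hJ.subset (hDJ' ⟨hx, hxe⟩)).resolve_left hxX).1
    rw [hD.eq_of_subset_isCircuit hC hDC] at hemp
    simp [hemp] at hCX
  · rintro x ⟨hx | hx, hxJ⟩
    · exact Or.inr ⟨hx, fun h ↦ hxJ (Or.inl h)⟩
    · by_cases hxe : x = e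
      · exact Or.inl hxe
      · exact (hxJ (Or.inr ⟨hx, hxe⟩)).elim

/-- Every finite set `S` lies in a finite set `X` of nullity at most `|S|`
in which the connectivity relation is the same as in the whole matroid. -/
theorem exists_superset_nullity_le {α : Type*} {M : Matroid α} [M.Finitary] {S : Set α}
    (hS : S.Finite) (hSE : S ⊆ M.E) :
    ∃ X I, S ⊆ X ∧ X.Finite ∧ X ⊆ M.E ∧ M.Indep I ∧ I ⊆ X ∧ (X \ I).ncard ≤ S.ncard ∧
      ∀ a ∈ X, ∀ b ∈ X, M.CircuitRel a b → (M ↾ X).CircuitRel a b := by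
  induction S, hS using Set.Finite.induction_on with
  | empty => exact ⟨∅, ∅, by simp⟩
  | @insert e S heS hS ih =>
  obtain ⟨X, I, hSX, hXfin, hXE, hI, hIX, hcard, hconn⟩ := ih ((subset_insert e S).trans hSE)
  have heE : e ∈ M.E := hSE (mem_insert e S)
  rw [ncard_insert_of_notMem heS hS]
  by_cases heX : e ∈ X
  · exact ⟨X, I, insert_subset heX hSX, hXfin, hXE, hI, hIX, by omega, hconn⟩
  have hins : (insert e (X \ I)).ncard ≤ S.ncard + 1 :=
    (ncard_insert_le e (X \ I)).trans (by omega)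
  have hfin : (insert e (X \ I)).Finite := (hXfin.sdiff).insert e
  by_cases hrel : ∃ p ∈ X, M.CircuitRel e p
  · obtain ⟨p, hpX, rfl | ⟨C, hC, heC, hpC⟩⟩ := hrel
    · exact (heX hpX).elim
    obtain ⟨D, J, hD, heD, ⟨q, hqD, hqX⟩, hJ, hJX, hsub⟩ :=
      hC.exists_ear heC heX ⟨p, hpC, hpX⟩ hXE hI hIX
    have hXDE : X ∪ D ⊆ M.E := union_subset hXE hD.subset_ground
    refine ⟨X ∪ D, J, insert_subset (Or.inr heD) (hSX.trans subset_union_left),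
      hXfin.union hD.finite, hXDE, hJ, hJX, (ncard_le_ncard hsub hfin).trans hins, ?_⟩
    -- Every new element is tied to `q ∈ X` by `D`, so relations in `X ∪ D` reduce to relations in
    -- `X`.
    have hrep : ∀ a ∈ X ∪ D, ∃ a' ∈ X, (M ↾ (X ∪ D)).CircuitRel a a' ∧ M.CircuitRel a a' := by
      rintro a (ha | ha)
      · exact ⟨a, ha, Or.inl rfl, Or.inl rfl⟩
      · exact ⟨q, hqX, Or.inr ⟨D, (restrict_isCircuit_iff hXDE).2 ⟨hD, subset_union_right⟩, ha,
          hqD⟩, Or.inr ⟨D, hD, ha, hqD⟩⟩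
    intro a ha b hb hab
    obtain ⟨a', ha', haa', haa⟩ := hrep a ha
    obtain ⟨b', hb', hbb', hbb⟩ := hrep b hb
    have := hconn a' ha' b' hb' ((haa.symm.trans hab).trans hbb)
    exact (haa'.trans (this.of_restrict subset_union_left hXDE)).trans hbb'.symm
  · push Not at hrel
    refine ⟨insert e X, I, insert_subset_insert hSX, hXfin.insert e, insert_subset heE hXE, hI,
      hIX.trans (subset_insert e X), ?_, ?_⟩
    · refine (ncard_le_ncard ?_ hfin).trans hins
      rintro x ⟨rfl | hx, hxI⟩
      · exact Or.inl rfl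
      · exact Or.inr ⟨hx, hxI⟩
    · rintro a (rfl | ha) b (rfl | hb) hab
      · exact Or.inl rfl
      · exact (hrel b hb hab).elim
      · exact (hrel a ha hab.symm).elim
      · exact (hconn a ha b hb hab).of_restrict (subset_insert e X) (insert_subset heE hXE)

/-- Every independent set `S` extends to a base `B` such that related elements of `S` lie in a
circuit with elements in `B` and a fixed set of at most `|S|` further elements. -/
theorem Indep.exists_isBase_circuits {α : Type*} {M : Matroid α} [M.RankFinite] {S : Set α}
    (hS : M.Indep S) :
    ∃ B X, M.IsBase B ∧ S ⊆ B ∧ X.Finite ∧ (X \ B).ncard ≤ S.ncard ∧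
      ∀ a ∈ S, ∀ b ∈ S, M.CircuitRel a b → a = b ∨ ∃ C ⊆ X, M.IsCircuit C ∧ a ∈ C ∧ b ∈ C := by
  obtain ⟨X, I, hSX, hXfin, hXE, hI, hIX, hcard, hconn⟩ :=
    exists_superset_nullity_le hS.finite hS.subset_ground
  obtain ⟨J, hJ, hSJ⟩ := hS.subset_isBasis_of_subset hSX hXE
  obtain ⟨K, hK, hIK⟩ := hI.subset_isBasis_of_subset hIX hXE
  obtain ⟨B, hB, hJB⟩ := hJ.indep.exists_isBase_superset
  refine ⟨B, X, hB, hSJ.trans hJB, hXfin, ?_, ?_⟩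
  -- All bases of `X` have equal size, so `|X \ J| = |X \ K| ≤ |X \ I|`.
  · have hJK : J.ncard = K.ncard := by
      rw [ncard_def, ncard_def, hJ.encard_eq_encard hK]
    have h₁ := ncard_sdiff_add_ncard_of_subset hJ.subset hXfin
    have h₂ := ncard_sdiff_add_ncard_of_subset hIX hXfin
    have h₃ := ncard_le_ncard hIK (hXfin.subset hK.subset)
    have h₄ : (X \ B).ncard ≤ (X \ J).ncard :=
      ncard_le_ncard (sdiff_subset_sdiff_right hJB) hXfin.sdiff
    omega
  · intro a ha b hb hab
    obtain h | ⟨C, hC, haC, hbC⟩ := hconn a (hSX ha) b (hSX hb) hab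
    · exact Or.inl h
    · rw [restrict_isCircuit_iff hXE] at hC
      exact Or.inr ⟨C, hC.2, hC.1, haC, hbC⟩

end Matroid

/-! ### Frames and exchange sequences -/

namespace Matroid

variable {α ι : Type*} {M : Matroid α}

/-- A frame of `M` is a family that enumerates a base without repetition. -/
def IsFrame (M : Matroid α) (v : ι → α) : Prop := Injective v ∧ M.IsBase (range v)

open Classical in
/-- `M.FrameStep v w`: the frame `w` arises from the frame `v` by one exchange step. -/
def FrameStep (M : Matroid α) (v w : ι → α) : Prop :=
  M.IsFrame v ∧ M.IsFrame w ∧ ∃ i x, x ∉ range v ∧ w = update v i x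

/-- `M.FrameReach n v w`: at most `n` exchange steps lead from `v` to `w`. -/
inductive FrameReach (M : Matroid α) : ℕ → (ι → α) → (ι → α) → Prop
  | refl (n : ℕ) (v : ι → α) : FrameReach M n v v
  | tail {n : ℕ} {u v w : ι → α} : FrameReach M n u v → M.FrameStep v w → FrameReach M (n + 1) u w

theorem range_update_of_injective [DecidableEq ι] {v : ι → α} (hv : Injective v) (i : ι) (x : α) :
    range (update v i x) = insert x (range v \ {v i}) := by
  ext y
  simp only [mem_range, mem_insert_iff, mem_sdiff, mem_singleton_iff]
  constructor
  · rintro ⟨j, rfl⟩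
    by_cases h : j = i
    · subst h; simp
    · exact Or.inr ⟨⟨j, by simp [h]⟩, by simpa [h] using hv.ne h⟩
  · rintro (rfl | ⟨⟨j, rfl⟩, h⟩)
    · exact ⟨i, by simp⟩
    · exact ⟨j, update_of_ne (fun h' : j = i ↦ h (by rw [h'])) _ _⟩

theorem injective_update_of_notMem_range [DecidableEq ι] {v : ι → α} (hv : Injective v) (i : ι)
    {x : α} (hx : x ∉ range v) : Injective (update v i x) := by
  intro j k h
  by_cases hj : j = i <;> by_cases hk : k = i
  · rw [hj, hk]
  · subst hj
    rw [update_self, update_of_ne hk] at h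
    exact (hx ⟨k, h.symm⟩).elim
  · subst hk
    rw [update_self, update_of_ne hj] at h
    exact (hx ⟨j, h⟩).elim
  · rw [update_of_ne hj, update_of_ne hk] at h
    exact hv h

theorem FrameStep.symm {v w : ι → α} (h : M.FrameStep v w) : M.FrameStep w v := by
  classical
  obtain ⟨hv, hw, i, x, hx, rfl⟩ := h
  refine ⟨hw, hv, i, v i, ?_, by simp⟩
  rintro ⟨j, hj⟩
  by_cases h : j = i
  · subst h
    rw [update_self] at hj
    exact hx ⟨j, hj.symm⟩
  · rw [update_of_ne h] at hj
    exact h (hv.1 hj)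

theorem IsFrame.comp_perm {v : ι → α} (hv : M.IsFrame v) (σ : Equiv.Perm ι) :
    M.IsFrame (v ∘ σ) :=
  ⟨hv.1.comp σ.injective, by rw [σ.surjective.range_comp]; exact hv.2⟩

theorem FrameStep.comp_perm {v w : ι → α} (h : M.FrameStep v w) (σ : Equiv.Perm ι) :
    M.FrameStep (v ∘ σ) (w ∘ σ) := by
  classical
  obtain ⟨hv, hw, i, x, hx, rfl⟩ := h
  refine ⟨hv.comp_perm σ, hw.comp_perm σ, σ.symm i, x, by rwa [σ.surjective.range_comp], ?_⟩
  rw [← update_comp_eq_of_injective v σ.injective, σ.apply_symm_apply]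

namespace FrameReach

theorem mono {m n : ℕ} {v w : ι → α} (h : M.FrameReach m v w) (hmn : m ≤ n) :
    M.FrameReach n v w := by
  induction h generalizing n with
  | refl => exact refl _ _
  | tail _ hs ih =>
    obtain ⟨n, rfl⟩ := Nat.exists_eq_add_of_le' (Nat.one_le_of_lt hmn)
    exact (ih (by omega)).tail hs

theorem trans {m n : ℕ} {u v w : ι → α} (h : M.FrameReach m u v) (h' : M.FrameReach n v w) :
    M.FrameReach (m + n) u w := by
  induction h' with
  | refl => exact h.mono (Nat.le_add_right ..)
  | tail _ hs ih => exact (ih h).tail hs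

theorem of_step {v w : ι → α} (h : M.FrameStep v w) : M.FrameReach 1 v w := (refl 0 v).tail h

theorem symm {n : ℕ} {v w : ι → α} (h : M.FrameReach n v w) : M.FrameReach n w v := by
  induction h with
  | refl => exact refl _ _
  | tail _ hs ih => exact ((of_step hs.symm).trans ih).mono (by omega)

/-- This allows conjugation: a detour `v → w`, once the labels are permuted by `σ`, is undone as `w
∘ σ → v ∘ σ`. -/
theorem comp_perm {n : ℕ} {v w : ι → α} (h : M.FrameReach n v w) (σ : Equiv.Perm ι) :
    M.FrameReach n (v ∘ σ) (w ∘ σ) := by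
  induction h with
  | refl => exact refl _ _
  | tail _ hs ih => exact ih.tail (hs.comp_perm σ)

end FrameReach

/-- The leaving element lies in the fundamental circuit of the entering one. -/
theorem FrameStep.circuitRel {v w : ι → α} (h : M.FrameStep v w) (j : ι) :
    M.CircuitRel (v j) (w j) := by
  classical
  obtain ⟨hv, hw, i, x, hx, rfl⟩ := h
  by_cases hj : j = i
  · subst hj
    have hB := hw.2
    rw [range_update_of_injective hv.1] at hB
    have hxE : x ∈ M.E := hB.subset_ground (mem_insert ..)
    have hxj : x ≠ v j := fun h ↦ hx ⟨j, h.symm⟩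
    rw [update_self]
    refine Or.inr ⟨_, hv.2.fundCircuit_isCircuit hxE hx, ?_, M.mem_fundCircuit ..⟩
    rw [hv.2.indep.mem_fundCircuit_iff (by rwa [hv.2.closure_eq]) hx,
      ← insert_sdiff_singleton_comm hxj]
    exact hB.indep
  · rw [update_of_ne hj]
    exact Or.inl rfl

theorem FrameReach.circuitRel [M.Finitary] {n : ℕ} {v w : ι → α} (h : M.FrameReach n v w) (j : ι) :
    M.CircuitRel (v j) (w j) := by
  induction h with
  | refl => exact Or.inl rfl
  | tail _ hs ih => exact ih.trans (hs.circuitRel j)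

theorem FrameReach.isFrame {n : ℕ} {v w : ι → α} (h : M.FrameReach n v w) (hv : M.IsFrame v) :
    M.IsFrame w := by
  cases h with
  | refl => exact hv
  | tail _ hs => exact hs.2.1

theorem IsFrame.frameStep [DecidableEq ι] {v : ι → α} (hv : M.IsFrame v) (i : ι) {x : α}
    (hx : x ∉ range v) (hB : M.IsBase (insert x (range v \ {v i}))) :
    M.FrameStep v (update v i x) :=
  ⟨hv, ⟨injective_update_of_notMem_range hv.1 i hx, by rwa [range_update_of_injective hv.1]⟩,
    i, x, hx, by congr!⟩

/-- A frame can be moved to any base `B`, without touching the elements in `B`. -/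
theorem IsFrame.exists_frameReach_isBase [M.RankFinite] {v : ι → α} (hv : M.IsFrame v) {B : Set α}
    (hB : M.IsBase B) :
    ∃ w, M.FrameReach (B \ range v).ncard v w ∧ range w = B ∧ ∀ i, v i ∈ B → w i = v i := by
  classical
  induction hn : (B \ range v).ncard using Nat.strong_induction_on generalizing v with
  | _ n ih =>
  subst hn
  by_cases hne : range v ⊆ B
  · exact ⟨v, .refl _ _, hv.2.eq_of_subset_isBase hB hne, fun _ _ ↦ rfl⟩
  obtain ⟨_, ⟨i, rfl⟩, hi⟩ := not_subset.1 hne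
  obtain ⟨x, ⟨hxB, hxv⟩, hx⟩ := hv.2.exchange hB ⟨mem_range_self i, hi⟩
  have hs := hv.frameStep i hxv hx
  have hr := range_update_of_injective hv.1 i x
  have hlt : (B \ range (update v i x)).ncard < (B \ range v).ncard := by
    refine ncard_lt_ncard ?_ hB.finite.sdiff
    rw [hr]
    refine ⟨fun y ⟨hy, hy'⟩ ↦ ⟨hy, fun h ↦ hy' (Or.inr ⟨h, ?_⟩)⟩, fun h ↦ ?_⟩
    · rintro rfl
      exact hi hy
    · exact (h ⟨hxB, hxv⟩).2 (mem_insert ..)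
  obtain ⟨w, hw, hwB, hwv⟩ := ih _ hlt hs.2.1 rfl
  refine ⟨w, ((FrameReach.of_step hs).trans hw).mono (by omega), hwB, fun j hj ↦ ?_⟩
  have hji : j ≠ i := by
    rintro rfl
    exact hi hj
  have := hwv j (by rwa [update_of_ne hji])
  rwa [update_of_ne hji] at this

/-- Two elements of a circuit that has only one element outside the base
can be interchanged in three steps. -/
theorem IsFrame.frameReach_swap_of_sdiff_singleton_subset [DecidableEq ι] {v : ι → α}
    (hv : M.IsFrame v) {C : Set α} {x : α} (hC : M.IsCircuit C) (hxC : x ∈ C)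
    (hCv : C \ {x} ⊆ range v) {i j : ι} (hij : i ≠ j) (hi : v i ∈ C) (hj : v j ∈ C)
    (hix : v i ≠ x) (hjx : v j ≠ x) : M.FrameReach 3 v (v ∘ Equiv.swap i j) := by
  have hxv : x ∉ range v := by
    intro h
    refine hC.not_indep (hv.2.indep.subset fun y hy ↦ ?_)
    by_cases hyx : y = x
    · exact hyx ▸ h
    · exact hCv ⟨hy, hyx⟩
  have hxE := hC.subset_ground hxC
  have hxcl : x ∈ M.closure (range v) := by rwa [hv.2.closure_eq]
  have hCeq : C = M.fundCircuit x (range v) := hC.eq_fundCircuit_of_subset hv.2.indep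
    fun y hy ↦ (em (y = x)).imp id fun h ↦ hCv ⟨hy, h⟩
  have hex : ∀ k, v k ∈ C → v k ≠ x → M.IsBase (insert x (range v \ {v k})) := by
    intro k hk hkx
    rw [hCeq, hv.2.indep.mem_fundCircuit_iff hxcl hxv, ← insert_sdiff_singleton_comm hkx.symm] at hk
    exact hv.2.exchange_isBase_of_indep hxv hk
  have hvij : v i ≠ v j := hv.1.ne hij
  -- `x` serves as a spare: it replaces `v i`, then `v i` replaces `v j`, then `v j` replaces `x`.
  have s₁ := hv.frameStep i hxv (hex i hi hix)
  have r₁ := range_update_of_injective hv.1 i x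
  have hn₁ : v i ∉ range (update v i x) := by
    rw [r₁]
    rintro (h | h)
    · exact hix h
    · exact h.2 rfl
  have e₁ : update v i x j = v j := update_of_ne hij.symm _ _
  have r₂' : insert (v i) (range (update v i x) \ {update v i x j}) =
      insert x (range v \ {v j}) := by
    rw [r₁, e₁]
    ext y
    simp only [mem_insert_iff, mem_sdiff, mem_singleton_iff]
    have : v i ∈ range v := mem_range_self i
    constructor
    · rintro (rfl | ⟨rfl | h, h'⟩)
      · exact Or.inr ⟨this, hvij⟩
      · exact Or.inl rfl
      · exact Or.inr ⟨h.1, h'⟩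
    · rintro (rfl | ⟨h, h'⟩)
      · exact Or.inr ⟨Or.inl rfl, hjx.symm⟩
      · by_cases hy : y = v i
        · exact Or.inl hy
        · exact Or.inr ⟨Or.inr ⟨h, hy⟩, h'⟩
  have s₂ := s₁.2.1.frameStep j hn₁ (by rw [r₂']; exact hex j hj hjx)
  have r₂ := (range_update_of_injective s₁.2.1.1 j (v i)).trans r₂'
  have hn₂ : v j ∉ range (update (update v i x) j (v i)) := by
    rw [r₂]
    rintro (h | h)
    · exact hjx h
    · exact h.2 rfl
  have e₂ : update (update v i x) j (v i) i = x := by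
    rw [update_of_ne hij, update_self]
  have r₃' : insert (v j) (range (update (update v i x) j (v i)) \
      {update (update v i x) j (v i) i}) = range v := by
    rw [r₂, e₂, insert_sdiff_self_of_notMem (fun h ↦ hxv h.1), insert_sdiff_singleton,
      insert_eq_of_mem (mem_range_self j)]
  have s₃ := s₂.2.1.frameStep i hn₂ (by rw [r₃']; exact hv.2)
  have : update (update (update v i x) j (v i)) i (v j) = v ∘ Equiv.swap i j := by
    ext k
    by_cases hki : k = i
    · subst hki; simp
    by_cases hkj : k = j
    · subst hkj; simp [hki]
    · simp [hki, hkj, Equiv.swap_apply_of_ne_of_ne]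
  rw [this] at s₃
  exact (((FrameReach.refl 0 v).tail s₁).tail s₂).tail s₃

/-- Two elements of a circuit with at most `n` elements outside the base can be interchanged in
`2 * n + 3` steps. -/
theorem IsFrame.frameReach_swap_of_isCircuit [M.RankFinite] [DecidableEq ι] {v : ι → α}
    (hv : M.IsFrame v) {C : Set α} (hC : M.IsCircuit C) {i j : ι} (hi : v i ∈ C) (hj : v j ∈ C) :
    M.FrameReach (2 * (C \ range v).ncard + 3) v (v ∘ Equiv.swap i j) := by
  obtain rfl | hij := eq_or_ne i j
  · simpa using FrameReach.refl _ v
  obtain ⟨x, hxC, hxv⟩ := not_subset.1 fun h ↦ hC.not_indep (hv.2.indep.subset h)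
  -- Extending `C \ {x}` only by elements of the old base keeps the detour to `B` within `|C \ range
  -- v|` steps each way.
  obtain ⟨B, hB, hCB, hBu⟩ :=
    (hC.sdiff_singleton_indep hxC).exists_isBase_subset_union_isBase hv.2
  have hix : v i ≠ x := fun h ↦ hxv ⟨i, h⟩
  have hjx : v j ≠ x := fun h ↦ hxv ⟨j, h⟩
  obtain ⟨w, hw, rfl, hwv⟩ := hv.exists_frameReach_isBase hB
  have hwi := hwv i (hCB ⟨hi, hix⟩)
  have hwj := hwv j (hCB ⟨hj, hjx⟩)
  have hsw := (hw.isFrame hv).frameReach_swap_of_sdiff_singleton_subset hC hxC hCB hij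
    (by rwa [hwi]) (by rwa [hwj]) (by rwa [hwi]) (by rwa [hwj])
  have hle : (range w \ range v).ncard ≤ (C \ range v).ncard :=
    ncard_le_ncard (fun y hy ↦ ⟨((hBu hy.1).resolve_right hy.2).1, hy.2⟩) hC.finite.sdiff
  exact ((hw.trans hsw).trans (hw.symm.comp_perm _)).mono (by omega)

/-! ### Products of transpositions -/

/-- The product of the transpositions in a list of pairs. -/
def swapProd [DecidableEq ι] (L : List (ι × ι)) : Equiv.Perm ι :=
  (L.map fun p ↦ Equiv.swap p.1 p.2).prod

theorem swapProd_append [DecidableEq ι] (L L' : List (ι × ι)) :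
    swapProd (L ++ L') = swapProd L * swapProd L' := by
  simp [swapProd]

theorem FrameReach.comp_mul {m n : ℕ} {v : ι → α} {σ τ : Equiv.Perm ι}
    (h : M.FrameReach m v (v ∘ σ)) (h' : M.FrameReach n v (v ∘ τ)) :
    M.FrameReach (m + n) v (v ∘ (σ * τ : Equiv.Perm ι)) :=
  (h'.trans (h.comp_perm τ)).mono (by omega)

theorem frameReach_swapProd [DecidableEq ι] {v : ι → α} {c : ℕ} {L : List (ι × ι)}
    (h : ∀ p ∈ L, M.FrameReach c v (v ∘ Equiv.swap p.1 p.2)) :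
    M.FrameReach (L.length * c) v (v ∘ swapProd L) := by
  induction L with
  | nil => exact .refl _ _
  | cons p L ih =>
    have h₁ := h p (by simp)
    have h₂ := ih fun q hq ↦ h q (by simp [hq])
    exact (h₁.comp_mul h₂).mono (by rw [List.length_cons]; linarith)

/-- Cuts the list into `q` batches of length at most `m`, so that each batch pays for only one
detour. -/
theorem frameReach_swapProd_of_length_le_mul [DecidableEq ι] {v : ι → α} {c m : ℕ}
    {L : List (ι × ι)}
    (h : ∀ L' : List (ι × ι), L' ⊆ L → L'.length ≤ m → M.FrameReach c v (v ∘ swapProd L')) (q : ℕ)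
    (hL : L.length ≤ q * m) : M.FrameReach (q * c) v (v ∘ swapProd L) := by
  induction q generalizing L with
  | zero =>
    obtain rfl : L = [] := by simpa using hL
    exact .refl _ _
  | succ q ih =>
    have h₁ := h (L.take m) (List.take_subset ..) (by simp)
    have h₂ := ih (L := L.drop m) (fun L' hL' ↦ h L' (List.Subset.trans hL' (List.drop_subset ..)))
      (by rw [List.length_drop]; rw [add_mul] at hL; omega)
    have := (h₁.comp_mul h₂).mono (n := (q + 1) * c) (by linarith)
    rwa [← swapProd_append, List.take_append_drop] at this

/-- A short product of transpositions of related elements is realized by first moving to a base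
in which the elements concerned are close to each other. -/
theorem IsFrame.frameReach_swapProd_of_circuitRel [M.RankFinite] [Fintype ι] [DecidableEq ι]
    {v : ι → α} (hv : M.IsFrame v) {m : ℕ} {L : List (ι × ι)} (hL : L.length ≤ m)
    (h : ∀ p ∈ L, M.CircuitRel (v p.1) (v p.2)) :
    M.FrameReach (2 * Fintype.card ι + m * (4 * m + 3)) v (v ∘ swapProd L) := by
  set T : Finset ι := (L.map Prod.fst ++ L.map Prod.snd).toFinset
  have hT : T.card ≤ 2 * m := (List.toFinset_card_le _).trans (by simp; omega)
  have hT₁ : ∀ p ∈ L, p.1 ∈ T := fun p hp ↦ by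
    simp only [T, List.mem_toFinset, List.mem_append, List.mem_map]
    exact Or.inl ⟨p, hp, rfl⟩
  have hT₂ : ∀ p ∈ L, p.2 ∈ T := fun p hp ↦ by
    simp only [T, List.mem_toFinset, List.mem_append, List.mem_map]
    exact Or.inr ⟨p, hp, rfl⟩
  have hScard : (v '' T).ncard ≤ 2 * m :=
    (ncard_image_le T.finite_toSet).trans (by rwa [ncard_coe_finset])
  obtain ⟨B, X, hB, hSB, hX, hXB, hrel⟩ :=
    (hv.2.indep.subset (image_subset_range v T)).exists_isBase_circuits
  obtain ⟨w, hw, rfl, hwv⟩ := hv.exists_frameReach_isBase hB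
  -- The endpoints stay in place during the detour, so the circuits found for `v` apply to `w`.
  have hwT : ∀ i ∈ T, w i = v i := fun i hi ↦ hwv i (hSB ⟨i, hi, rfl⟩)
  have hfr := hw.isFrame hv
  have hsw : ∀ p ∈ L, M.FrameReach (4 * m + 3) w (w ∘ Equiv.swap p.1 p.2) := by
    intro p hp
    obtain hp' | ⟨C, hCX, hC, h₁, h₂⟩ :=
      hrel _ ⟨p.1, hT₁ p hp, rfl⟩ _ ⟨p.2, hT₂ p hp, rfl⟩ (h p hp)
    · rw [hv.1 hp', Equiv.swap_self]
      exact .refl _ _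
    · have hle : (C \ range w).ncard ≤ (X \ range w).ncard :=
        ncard_le_ncard (sdiff_subset_sdiff_left hCX) hX.sdiff
      refine (hfr.frameReach_swap_of_isCircuit hC ?_ ?_).mono (by omega)
      · rwa [hwT _ (hT₁ p hp)]
      · rwa [hwT _ (hT₂ p hp)]
  have hcard : (range w \ range v).ncard ≤ Fintype.card ι := by
    refine (ncard_le_ncard sdiff_subset (finite_range w)).trans ?_
    rw [← image_univ, ← Nat.card_eq_fintype_card, ← ncard_univ]
    exact ncard_image_le finite_univ
  refine ((hw.trans (frameReach_swapProd hsw)).trans (hw.symm.comp_perm _)).mono ?_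
  have := Nat.mul_le_mul_right (4 * m + 3) hL
  omega

/-- A permutation within the classes of an equivalence relation is a product of few transpositions
within the classes. -/
theorem exists_swapProd_eq [Fintype ι] [DecidableEq ι] {R : ι → ι → Prop} (hR : Equivalence R)
    (σ : Equiv.Perm ι) (hσ : ∀ i, R i (σ i)) :
    ∃ L : List (ι × ι), L.length ≤ Fintype.card ι ∧ (∀ p ∈ L, R p.1 p.2) ∧ swapProd L = σ := by
  -- Multiplying by `swap i (σ i)` fixes `i` and shrinks the support, so the support size bounds the
  -- length.
  suffices h : ∃ L : List (ι × ι), L.length ≤ σ.support.card ∧ (∀ p ∈ L, R p.1 p.2) ∧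
      swapProd L = σ by
    obtain ⟨L, hL, h⟩ := h
    exact ⟨L, hL.trans (Finset.card_le_univ _), h⟩
  induction hn : σ.support.card using Nat.strong_induction_on generalizing σ with
  | _ n ih =>
  subst hn
  by_cases hone : σ = 1
  · exact ⟨[], by simp, by simp, by simp [swapProd, hone]⟩
  obtain ⟨i, hi⟩ : ∃ i, σ i ≠ i := by
    by_contra! h
    exact hone (Equiv.ext h)
  have hlt := Equiv.Perm.card_support_swap_mul hi
  have hswap : ∀ k, R k (Equiv.swap i (σ i) k) := by
    intro k
    by_cases hk : k = i
    · subst hk; simpa using hσ k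
    by_cases hk' : k = σ i
    · subst hk'; simpa using hR.symm (hσ i)
    · rw [Equiv.swap_apply_of_ne_of_ne hk hk']
      exact hR.refl k
  obtain ⟨L, hL, hLR, hLσ⟩ := ih _ hlt (Equiv.swap i (σ i) * σ)
    (fun k ↦ hR.trans (hσ k) (hswap _)) rfl
  refine ⟨(i, σ i) :: L, by rw [List.length_cons]; omega, ?_, ?_⟩
  · intro p hp
    obtain rfl | hp := List.mem_cons.1 hp
    · exact hσ i
    · exact hLR p hp
  · have : swapProd ((i, σ i) :: L) = Equiv.swap i (σ i) * swapProd L := by simp [swapProd]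
    rw [this, hLσ, Equiv.swap_mul_self_mul]

/-- The combinatorial bound, with a parameter `m` for the number of transpositions that are
performed together. -/
theorem IsFrame.frameReach_of_circuitRel [M.RankFinite] [Fintype ι] [DecidableEq ι] {v w : ι → α}
    (hv : M.IsFrame v) (hw : M.IsFrame w) (h : ∀ i, M.CircuitRel (v i) (w i)) {m : ℕ}
    (hm : Fintype.card ι ≤ m * m) :
    M.FrameReach (Fintype.card ι + m * (2 * Fintype.card ι + m * (4 * m + 3))) v w := by
  obtain ⟨u, hu, huw, -⟩ := hv.exists_frameReach_isBase hw.2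
  have hu' := hu.isFrame hv
  have hmem : ∀ i, ∃ j, u j = w i := fun i ↦ by
    have : w i ∈ range u := huw ▸ mem_range_self i
    exact this
  choose f hf using hmem
  have hinj : Injective f := fun i j hij ↦ hw.1 (by rw [← hf i, ← hf j, hij])
  let σ : Equiv.Perm ι := Equiv.ofBijective f (Finite.injective_iff_bijective.1 hinj)
  have hσ : u ∘ σ = w := funext hf
  obtain ⟨L, hL, hLR, hLσ⟩ := exists_swapProd_eq (R := fun i j ↦ M.CircuitRel (u i) (u j))
    ⟨fun _ ↦ Or.inl rfl, fun h ↦ h.symm, fun h h' ↦ h.trans h'⟩ σ fun i ↦ by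
      have : u (σ i) = w i := hf i
      rw [this]
      exact (hu.circuitRel i).symm.trans (h i)
  have hperm := frameReach_swapProd_of_length_le_mul (M := M) (v := u) (L := L)
    (fun L' hL' hlen ↦ hu'.frameReach_swapProd_of_circuitRel hlen fun p hp ↦ hLR p (hL' hp)) m
    (hL.trans hm)
  rw [hLσ, hσ] at hperm
  have hcard : (range w \ range v).ncard ≤ Fintype.card ι := by
    refine (ncard_le_ncard sdiff_subset (finite_range w)).trans ?_
    rw [← image_univ, ← Nat.card_eq_fintype_card, ← ncard_univ]
    exact ncard_image_le finite_univ
  exact (hu.trans hperm).mono (by omega)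

end Matroid

/-! ### Labelled bases as frames -/

namespace Matroid.LabelledBasis

variable {α : Type*} {M : Matroid α} {r : ℕ}

theorem range_elt (T : M.LabelledBasis r) : range T.elt = T.basis := by
  ext x
  constructor
  · rintro ⟨i, rfl⟩
    exact (T.label.symm i).2
  · intro hx
    exact ⟨T.label ⟨x, hx⟩, by simp [elt]⟩

theorem elt_label (T : M.LabelledBasis r) {x : α} (hx : x ∈ T.basis) :
    T.elt (T.label ⟨x, hx⟩) = x := by simp [elt]

theorem label_elt (T : M.LabelledBasis r) {i : Fin r} (hx : T.elt i ∈ T.basis) :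
    T.label ⟨T.elt i, hx⟩ = i := by simp [elt]

theorem injective_elt (T : M.LabelledBasis r) : Injective T.elt :=
  Subtype.val_injective.comp T.label.symm.injective

theorem isFrame_elt (T : M.LabelledBasis r) : M.IsFrame T.elt :=
  ⟨T.injective_elt, T.range_elt ▸ T.isBase⟩

theorem label_eq_iff (T : M.LabelledBasis r) {x : α} (hx : x ∈ T.basis) {i : Fin r} :
    T.label ⟨x, hx⟩ = i ↔ T.elt i = x := by
  constructor
  · rintro rfl
    exact T.elt_label hx
  · rintro rfl
    exact T.label_elt hx

theorem elt_injective : Injective (elt : M.LabelledBasis r → Fin r → α) := by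
  intro T T' h
  have hb : T.basis = T'.basis := by rw [← range_elt, ← range_elt, h]
  obtain ⟨B, hB, l⟩ := T
  obtain ⟨B', hB', l'⟩ := T'
  obtain rfl : B = B' := hb
  have : l.symm = l'.symm := Equiv.ext fun i ↦ Subtype.ext (congrFun h i)
  rw [Equiv.symm_bijective.injective this]

/-- The labelled basis that a frame indexed by the labels defines. -/
noncomputable def ofFrame {v : Fin r → α} (hv : M.IsFrame v) : M.LabelledBasis r :=
  ⟨range v, hv.2, (Equiv.ofInjective v hv.1).symm⟩

theorem elt_ofFrame {v : Fin r → α} (hv : M.IsFrame v) : (ofFrame hv).elt = v := rfl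

theorem exchange_of_frameStep {T T' : M.LabelledBasis r} (h : M.FrameStep T.elt T'.elt) :
    T.Exchange T' := by
  obtain ⟨-, -, i, x, hx, hT'⟩ := h
  replace hT' : T'.elt = update T.elt i x := hT'.trans (by congr!)
  have hbasis : T'.basis = insert x (T.basis \ {T.elt i}) := by
    rw [← range_elt, ← range_elt, ← range_update_of_injective T.injective_elt, hT']
  have hx' : x ∈ T'.basis := hbasis ▸ mem_insert ..
  have hi : T.elt i ∈ T.basis := T.range_elt ▸ mem_range_self i
  rw [range_elt] at hx
  refine ⟨T.elt i, x, hi, hx', ⟨T'.isBase.subset_ground hx', hx⟩, hbasis, ?_, ?_⟩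
  · rw [label_elt, label_eq_iff, hT', update_self]
  · intro y hy hy'
    rw [label_eq_iff, hT', update_of_ne, elt_label]
    intro h
    rw [label_eq_iff] at h
    rw [hbasis] at hy'
    rcases hy' with rfl | hy'
    · exact hx hy
    · exact hy'.2 h.symm

theorem exists_reconfigurableIn_of_frameReach {n : ℕ} {v w : Fin r → α}
    (h : M.FrameReach n v w) {T : M.LabelledBasis r} (hT : T.elt = v) :
    ∃ T' : M.LabelledBasis r, T'.elt = w ∧ ∃ k ≤ n, ReconfigurableIn k T T' := by
  induction h with
  | refl n v => exact ⟨T, hT, 0, n.zero_le, .refl T⟩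
  | tail _ hs ih =>
    obtain ⟨T', rfl, k, hk, hTT'⟩ := ih hT
    exact ⟨ofFrame hs.2.1, elt_ofFrame _, k + 1, by omega, hTT'.tail (exchange_of_frameStep hs)⟩

end Matroid.LabelledBasis

/-! ### The numerical bound and the theorem -/

theorem add_sqrt_mul_le_rpow {r : ℕ} (hr : 0 < r) :
    ((r + (r.sqrt + 1) * (2 * r + (r.sqrt + 1) * (4 * (r.sqrt + 1) + 3)) : ℕ) : ℝ) ≤
      49 * (r : ℝ) ^ (3 / 2 : ℝ) := by
  set s := Real.sqrt r
  have hs2 : s ^ 2 = r := Real.sq_sqrt (Nat.cast_nonneg r)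
  have hs1 : 1 ≤ s := Real.one_le_sqrt.2 (by exact_mod_cast hr)
  have hpow : (r : ℝ) ^ (3 / 2 : ℝ) = s ^ 3 := by
    rw [show s = (r : ℝ) ^ (1 / 2 : ℝ) from Real.sqrt_eq_rpow _, ← Real.rpow_natCast,
      ← Real.rpow_mul (Nat.cast_nonneg r)]
    norm_num
  -- The rounding `+ 1` is absorbed since `1 ≤ √r`; this is why `r = 0` is excluded.
  have hm : (r.sqrt : ℝ) + 1 ≤ 2 * s := by
    linarith [Real.nat_sqrt_le_real_sqrt (a := r)]
  push_cast
  rw [hpow, ← hs2]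
  have h23 : s ^ 2 ≤ s ^ 3 := pow_le_pow_right₀ hs1 (by norm_num)
  calc s ^ 2 + ((r.sqrt : ℝ) + 1) * (2 * s ^ 2 + (r.sqrt + 1) * (4 * (r.sqrt + 1) + 3))
      ≤ s ^ 2 + 2 * s * (2 * s ^ 2 + 2 * s * (4 * (2 * s) + 3)) := by gcongr
    _ = 36 * s ^ 3 + 13 * s ^ 2 := by ring
    _ ≤ 49 * s ^ 3 := by linarith

theorem mainTheorem1 :
    ∃ C : ℝ, ∀ (α : Type*) (M : Matroid α) (r : ℕ), M.eRank = (r : ℕ∞) →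
      ∀ T₁ T₂ : M.LabelledBasis r,
        (∀ i : Fin r, ∃ K : Set α, M.IsConnectedComponent K ∧ T₁.elt i ∈ K ∧ T₂.elt i ∈ K) →
        ∃ k : ℕ, (k : ℝ) ≤ C * (r : ℝ) ^ (3 / 2 : ℝ) ∧
          Matroid.LabelledBasis.ReconfigurableIn k T₁ T₂ := by
  refine ⟨49, fun α M r _ T₁ T₂ hK ↦ ?_⟩
  obtain rfl | hr := r.eq_zero_or_pos
  · obtain rfl : T₁ = T₂ := Matroid.LabelledBasis.elt_injective (Subsingleton.elim _ _)
    exact ⟨0, by simp [Real.zero_rpow], .refl T₁⟩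
  have hfr₁ := T₁.isFrame_elt
  have : M.RankFinite := hfr₁.2.rankFinite_of_finite (finite_range _)
  have hrel : ∀ i, M.CircuitRel (T₁.elt i) (T₂.elt i) := by
    intro i
    obtain ⟨_, ⟨e, -, rfl⟩, h₁, h₂⟩ := hK i
    exact h₁.2.symm.trans h₂.2
  have hreach := hfr₁.frameReach_of_circuitRel T₂.isFrame_elt hrel (m := r.sqrt + 1)
    (by rw [Fintype.card_fin]; exact (Nat.lt_succ_sqrt r).le)
  rw [Fintype.card_fin] at hreach
  obtain ⟨T', hT', k, hk, hrec⟩ :=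
    Matroid.LabelledBasis.exists_reconfigurableIn_of_frameReach hreach rfl
  rw [Matroid.LabelledBasis.elt_injective hT'] at hrec
  exact ⟨k, (Nat.cast_le.2 hk).trans (add_sqrt_mul_le_rpow hr), hrec⟩
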